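/- Throughout, topological spaces are non-empty. **Modal language.** Modal formulas are built from countably many propositional letters $p_1,p_2,\dots$ by $\phi ::= \top \mid p_i \mid \phi\wedge\phi \mid \neg\phi \mid \Box\phi$. Given a space $X$ and a valuation $\nu$ assigning a subset $\nu(p_i)\subseteq X$ to each letter, $\top,\wedge,\neg$ have their usual meaning, $p_i$ is true at $w$ iff $w\in\nu(p_i)$, and $\Box\phi$ is true at $w$ iff there is an open set $O\ni w$ with $\phi$ true at every point of $O$. Write $X\models\phi$ if $\phi$ is true at all points of $X$ under all valuations. A class $\mathsf K$ of spaces is *modally definable* if there is a set $\Gamma$ of modal formulas such that, for every space $X$, $X\in\mathsf K$ iff $X\models\phi$ for all $\phi\in\Gamma$. **The language $\mathcal L_t$.** Consider the two-sorted first-order language $\mathcal L^2$ with point variables $x,y,\dots$, interpreted as points of a space, and open variables $U,V,\dots$, interpreted as open sets. Its formulas are $\phi ::= \top \mid x=y \mid U=V \mid x\,\varepsilon\,U \mid \neg\phi \mid \phi\wedge\phi \mid \exists x.\phi \mid \exists U.\phi$, where $\varepsilon$ is membership; $\phi\to\psi$ abbreviates $\neg(\phi\wedge\neg\psi)$ and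 $\forall$ abbreviates $\neg\exists\neg$. A formula is *positive* (*negative*) in $U$ if every free occurrence of $U$ is under an even (odd) number of negation signs, where an occurrence of $U$ in an equation between open variables counts as both positive and negative (so a formula in which $U$ occurs free in such an equation is neither positive nor negative in $U$). $\mathcal L_t$ is the least set of $\mathcal L^2$-formulas that contains the atomic formulas, is closed under $\neg$, $\wedge$ and $\exists x$, contains $\forall U.(x\,\varepsilon\,U\to\alpha)$ whenever it contains $\alpha$ and $\alpha$ is positive in $U$, and contains $\exists U.(x\,\varepsilon\,U\wedge\alpha)$ whenever it contains $\alpha$ and $\alpha$ is negative in $U$. A class $\mathsf K$ of spaces is *$\mathcal L_t$-definable* if there is a set $\Gamma$ of $\mathcal L_t$-sentences such that, for every space $X$, $X\in\mathsf K$ iff all members of $\Gamma$ are true in $X$. **Alexandroff extension.** A filter $\mathcal F$ on a space $X$ is *open* if $A\in\mathcal F$ implies $\operatorname{int}A\in\mathcal F$. The Alexandroff extension $X^*$ of $X$ is the set of all ultrafilters on the set $X$, with the topology generated by the sets $\{\mathfrak u \mid \mathcal F\subseteq\mathfrak u\}$ for $\mathcal F$ an open filter on $X$. **Theorem.** Let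 $\mathsf K$ be an $\mathcal L_t$-definable class of topological spaces. Then $\mathsf K$ is modally definable if and only if all of the following hold: 1. if $X\in\mathsf K$ and $O\subseteq X$ is open and non-empty, then the subspace $O$ is in $\mathsf K$; 2. if $X\in\mathsf K$ and $f:X\to Y$ is a surjective continuous open map onto a space $Y$, then $Y\in\mathsf K$; 3. if $(X_i)_{i\in I}$ is a non-empty family of members of $\mathsf K$, then its topological sum (disjoint union) is in $\mathsf K$; 4. for every space $X$, if $X^*\in\mathsf K$ then $X\in\mathsf K$. -/

import Mathlib

universe u v

namespace TopoModal

/-! ### Spaces and classes of spaces -/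

/-- A topological space in the sense used here: a nonempty set with a topology.
A class of topological spaces is a `Set Space`. -/
structure Space : Type (u + 1) where
  carrier : Type u
  [top : TopologicalSpace carrier]
  [ne : Nonempty carrier]

attribute [instance] Space.top Space.ne

instance : CoeSort Space.{u} (Type u) := ⟨Space.carrier⟩

/-! ### The basic modal language and its topological semantics -/

/-- Modal formulas over the set `P` of propositional letters. -/
inductive ModalFormula (P : Type v) : Type v
  | top : ModalFormula P
  | letter (p : P) : ModalFormula P
  | and (φ ψ : ModalFormula P) : ModalFormula P
  | neg (φ : ModalFormula P) : ModalFormula P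
  | box (φ : ModalFormula P) : ModalFormula P

/-- Truth of a modal formula at the point `w` of the topological model `(X, ν)`. -/
def ModalFormula.Truth {P : Type v} {X : Type u} [TopologicalSpace X] (ν : P → Set X) :
    X → ModalFormula P → Prop
  | _, .top => True
  | w, .letter p => w ∈ ν p
  | w, .and φ ψ => Truth ν w φ ∧ Truth ν w ψ
  | w, .neg φ => ¬ Truth ν w φ
  | w, .box φ => ∃ O : Set X, IsOpen O ∧ w ∈ O ∧ ∀ v ∈ O, Truth ν v φ

/-- `X ⊨ φ`: the formula is true at every point under every valuation. -/
def ModalFormula.Valid {P : Type v} (X : Type u) [TopologicalSpace X] (φ : ModalFormula P) : Prop :=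
  ∀ (ν : P → Set X) (w : X), φ.Truth ν w

/-- The class `K` is definable in the basic modal language, whose set of propositional letters is
countably infinite: some set of modal formulas defines it. -/
def ModallyDefinable (K : Set Space.{u}) : Prop :=
  ∃ Γ : Set (ModalFormula ℕ), ∀ X : Space.{u}, X ∈ K ↔ ∀ φ ∈ Γ, φ.Valid X

/-! ### The two-sorted language `L²` -/

/-- Formulas of the two-sorted language `L²` with a unary predicate symbol for each element of `P`.
Point variables and open variables are both indexed by `ℕ`. -/
inductive L2 (P : Type v) : Type v
  | top : L2 P
  /-- `x = y` for point variables -/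
  | eqPt (x y : ℕ) : L2 P
  /-- `U = V` for open variables -/
  | eqOp (U V : ℕ) : L2 P
  /-- `P_p(x)` -/
  | pred (p : P) (x : ℕ) : L2 P
  /-- `x ε U` -/
  | mem (x U : ℕ) : L2 P
  | neg (φ : L2 P) : L2 P
  | and (φ ψ : L2 P) : L2 P
  /-- `∃ x. φ` -/
  | exPt (x : ℕ) (φ : L2 P) : L2 P
  /-- `∃ U. φ` -/
  | exOp (U : ℕ) (φ : L2 P) : L2 P

namespace L2

variable {P : Type v}

/-- `φ → ψ` abbreviates `¬(φ ∧ ¬ψ)`. -/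
def imp (φ ψ : L2 P) : L2 P := .neg (.and φ (.neg ψ))

/-- `∀ U. φ` abbreviates `¬∃ U. ¬φ`. -/
def allOp (U : ℕ) (φ : L2 P) : L2 P := .neg (.exOp U (.neg φ))

/-- Satisfaction, with the open variables ranging over the collection `σ` of subsets of `X`;
`ν` interprets the predicate symbols, `g` and `h` assign values to the point variables and
to the open variables. -/
def Sat {X : Type u} (σ : Set (Set X)) (ν : P → Set X) :
    (ℕ → X) → (ℕ → Set X) → L2 P → Prop
  | _, _, .top => True
  | g, _, .eqPt x y => g x = g y
  | _, h, .eqOp U V => h U = h V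
  | g, _, .pred p x => g x ∈ ν p
  | g, h, .mem x U => g x ∈ h U
  | g, h, .neg φ => ¬ Sat σ ν g h φ
  | g, h, .and φ ψ => Sat σ ν g h φ ∧ Sat σ ν g h ψ
  | g, h, .exPt x φ => ∃ d : X, Sat σ ν (Function.update g x d) h φ
  | g, h, .exOp U φ => ∃ O ∈ σ, Sat σ ν g (Function.update h U O) φ

/-- The point variable `z` occurs free in the formula. -/
def FreePt (z : ℕ) : L2 P → Prop
  | .top => False
  | .eqPt x y => z = x ∨ z = y
  | .eqOp _ _ => False
  | .pred _ x => z = x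
  | .mem x _ => z = x
  | .neg φ => FreePt z φ
  | .and φ ψ => FreePt z φ ∨ FreePt z ψ
  | .exPt x φ => z ≠ x ∧ FreePt z φ
  | .exOp _ φ => FreePt z φ

/-- `FreeOp W s φ`: the open variable `W` has a free occurrence in `φ` under an even (`s = true`) or
odd (`s = false`) number of negation signs. An equation `U = V` between open variables stands for
mutual inclusion, so an occurrence in it counts with both parities; if it counted with one parity
only, then `L_t` below would not be invariant under a change of base. -/
def FreeOp (W : ℕ) : Bool → L2 P → Prop
  | _, .top => False
  | _, .eqPt _ _ => False
  | _, .eqOp U V => W = U ∨ W = V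
  | _, .pred _ _ => False
  | s, .mem _ U => s = true ∧ W = U
  | s, .neg φ => FreeOp W (!s) φ
  | s, .and φ ψ => FreeOp W s φ ∨ FreeOp W s ψ
  | s, .exPt _ φ => FreeOp W s φ
  | s, .exOp U φ => W ≠ U ∧ FreeOp W s φ

/-- All free occurrences of `U` are under an even number of negation signs. -/
def PositiveIn (U : ℕ) (φ : L2 P) : Prop := ¬ FreeOp U false φ

/-- All free occurrences of `U` are under an odd number of negation signs. -/
def NegativeIn (U : ℕ) (φ : L2 P) : Prop := ¬ FreeOp U true φ

/-- A sentence has no free point variables and no free open variables. -/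
def IsSentence (φ : L2 P) : Prop :=
  (∀ x, ¬ FreePt x φ) ∧ ∀ U s, ¬ FreeOp U s φ

/-- The formulas of the fragment `L_t` of `L²`. -/
inductive IsLt : L2 P → Prop
  | top : IsLt .top
  | eqPt (x y : ℕ) : IsLt (.eqPt x y)
  | eqOp (U V : ℕ) : IsLt (.eqOp U V)
  | pred (p : P) (x : ℕ) : IsLt (.pred p x)
  | mem (x U : ℕ) : IsLt (.mem x U)
  | neg {φ : L2 P} : IsLt φ → IsLt (.neg φ)
  | and {φ ψ : L2 P} : IsLt φ → IsLt ψ → IsLt (.and φ ψ)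
  | exPt (x : ℕ) {φ : L2 P} : IsLt φ → IsLt (.exPt x φ)
  /-- `∀ U. (x ε U → α)` with `α` positive in `U` -/
  | allOp (x U : ℕ) {α : L2 P} : IsLt α → PositiveIn U α →
      IsLt (L2.allOp U (L2.imp (.mem x U) α))
  /-- `∃ U. (x ε U ∧ α)` with `α` negative in `U` -/
  | exOp (x U : ℕ) {α : L2 P} : IsLt α → NegativeIn U α →
      IsLt (.exOp U (.and (.mem x U) α))

/-- Truth of a formula in a topological space, for the signature without predicate symbols: open
variables range over all open sets, and the formula holds under every assignment. -/
def HoldsIn (X : Type u) [TopologicalSpace X] (φ : L2 Empty) : Prop :=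
  ∀ (g : ℕ → X) (h : ℕ → Set X), (∀ U, IsOpen (h U)) →
    Sat {O : Set X | IsOpen O} (fun p : Empty => p.elim) g h φ

end L2

/-- The class `K` is `L_t`-definable: some set of `L_t`-sentences (about spaces, hence without
predicate symbols) defines it. -/
def LtDefinable (K : Set Space.{u}) : Prop :=
  ∃ Γ : Set (L2 Empty), (∀ φ ∈ Γ, φ.IsLt ∧ φ.IsSentence) ∧
    ∀ X : Space.{u}, X ∈ K ↔ ∀ φ ∈ Γ, φ.HoldsIn X

/-! ### Operations on spaces -/

/-- `K` contains every open subspace (on a nonempty open set) of each of its members. -/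
def ClosedUnderOpenSubspaces (K : Set Space.{u}) : Prop :=
  ∀ X ∈ K, ∀ (O : Set X), IsOpen O → ∀ hne : O.Nonempty,
    ({ carrier := O, ne := hne.to_subtype } : Space.{u}) ∈ K

/-- `K` contains the image of each of its members under each interior (continuous and open) map. -/
def ClosedUnderInteriorImages (K : Set Space.{u}) : Prop :=
  ∀ X ∈ K, ∀ (Y : Space.{u}) (f : X → Y),
    Continuous f → IsOpenMap f → Function.Surjective f → Y ∈ K

/-- `K` contains the topological sum of each nonempty family of its members. -/
def ClosedUnderSums (K : Set Space.{u}) : Prop :=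
  ∀ (I : Type u) [Nonempty I] (X : I → Space.{u}), (∀ i, X i ∈ K) →
    ({ carrier := Σ i, X i, ne := nonempty_sigma.mpr ⟨Classical.arbitrary I, inferInstance⟩ } :
      Space.{u}) ∈ K

/-- A filter on a topological space is open if it contains the interior of each of its members. -/
def IsOpenFilter {X : Type u} [TopologicalSpace X] (F : Filter X) : Prop :=
  ∀ A ∈ F, interior A ∈ F

/-- The set of ultrafilters over `X`, as the carrier of the Alexandroff extension. (A wrapper,
because Mathlib puts another topology on `Ultrafilter X`.) -/
structure AlexExt (X : Type u) : Type u where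
  toUltrafilter : Ultrafilter X

/-- The topology of the Alexandroff extension, generated by the sets `{u | F ⊆ u}` for open
filters `F`. -/
instance (X : Type u) [TopologicalSpace X] : TopologicalSpace (AlexExt X) :=
  TopologicalSpace.generateFrom
    {S | ∃ F : Filter X, IsOpenFilter F ∧ S = {u : AlexExt X | ∀ A ∈ F, A ∈ u.toUltrafilter}}

instance (X : Type u) [Nonempty X] : Nonempty (AlexExt X) :=
  ⟨⟨pure (Classical.arbitrary X)⟩⟩

/-- The Alexandroff extension `X*` of a space. -/
def Space.alexandroffExtension (X : Space.{u}) : Space.{u} := { carrier := AlexExt X }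

/-- `K` reflects Alexandroff extensions. -/
def ReflectsAlexandroffExtensions (K : Set Space.{u}) : Prop :=
  ∀ X : Space.{u}, X.alexandroffExtension ∈ K → X ∈ K

end TopoModal

/-!
Modal validity passes to open subspaces, interior images and sums, because truth is invariant under
continuous open maps (`ModalFormula.truth_preimage`). It is reflected by the Alexandroff extension,
because a formula is true at an ultrafilter exactly if its truth set belongs to the ultrafilter
(`ModalFormula.truth_alexExt`). So modally definable classes have the four closure properties.

For the converse let `X` validate the modal logic of an `L_t`-definable class `K` with the closure
properties, and take a letter for each subset of `X`. A finite part of the diagram of `X` (which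
says that the letters respect intersections, complements and interiors) mentions finitely many
letters, so it holds on an open set of some member of `K`, together with the letter of any given
singleton: otherwise its negation would belong to the logic of `K` and fail in `X`. The sum of these
members is a single `Y` in `K` that satisfies all finite parts (`exists_valuation_of_sums`).

Next, `Y` is replaced by a sufficiently saturated limit ultrapower, whose topology has the internal
open sets as a base. Łoś's theorem (`LimitPower.sat_internalOpens_iff`) describes truth when open
variables range over this base, and formulas of `L_t` do not distinguish a base from its topology
(`L2.IsLt.sat_iff_of_isTopologicalBasis`), so the limit ultrapower is in `K`. The whole diagram holds
on an open part of it. Sending a point of that part to the set of those `A` whose letter is true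
there gives a continuous open surjection onto the Alexandroff extension of `X`, which is therefore
in `K`, and so is `X`.

Openness and surjectivity of this map require realizing types with an internal open set as a
parameter (`LimitPower.exists_mem_internal`). One ultrapower would need a good ultrafilter for this.
Instead, ultrapowers are iterated `ω` times, and each type is realized one step after its parameter
has appeared. The union of this chain is presented as a set of germs of functions on sequences that
depend on finitely many coordinates, modulo the limit of the tensor powers of a fine ultrafilter.
-/

namespace TopoModal

/-! ### Preservation of modal validity -/

section Modal

variable {P : Type v} {X Y : Type u} [TopologicalSpace X] [TopologicalSpace Y]

theorem ModalFormula.truth_box (ν : P → Set X) (w : X) (φ : ModalFormula P) :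
    (ModalFormula.box φ).Truth ν w ↔ w ∈ interior {v | φ.Truth ν v} := by
  rw [mem_interior]
  exact ⟨fun ⟨O, hO, hw, h⟩ => ⟨O, h, hO, hw⟩, fun ⟨O, h, hO, hw⟩ => ⟨O, hO, hw, h⟩⟩

/-- Truth is invariant under continuous open maps. Open inclusions, the injections into a sum, and
interior images are all instances. -/
theorem ModalFormula.truth_preimage {f : X → Y} (hc : Continuous f) (ho : IsOpenMap f)
    (ν : P → Set Y) (φ : ModalFormula P) (w : X) :
    φ.Truth (fun p => f ⁻¹' ν p) w ↔ φ.Truth ν (f w) := by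
  induction φ generalizing w with
  | top => rfl
  | letter p => rfl
  | and φ ψ h₁ h₂ => exact and_congr (h₁ w) (h₂ w)
  | neg φ h => exact not_congr (h w)
  | box φ h =>
    have hset : {v | φ.Truth (fun p => f ⁻¹' ν p) v} = f ⁻¹' {v | φ.Truth ν v} := Set.ext h
    rw [truth_box, truth_box, hset, ← ho.preimage_interior_eq_interior_preimage hc]
    rfl

theorem ModalFormula.Valid.of_surjective {f : X → Y} (hc : Continuous f) (ho : IsOpenMap f)
    (hf : Function.Surjective f) {φ : ModalFormula P} (h : φ.Valid X) : φ.Valid Y := by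
  intro ν w
  obtain ⟨x, rfl⟩ := hf w
  exact (truth_preimage hc ho ν φ x).1 (h _ x)

theorem ModalFormula.Valid.of_isOpen {φ : ModalFormula P} (h : φ.Valid X) {O : Set X}
    (hO : IsOpen O) : φ.Valid O := by
  intro ν w
  have := (truth_preimage continuous_subtype_val hO.isOpenMap_subtype_val
    (fun p => Subtype.val '' ν p) φ w).2 (h _ _)
  simpa only [Set.preimage_image_eq _ Subtype.val_injective] using this

theorem ModalFormula.Valid.sigma {I : Type u} {Z : I → Type u} [∀ i, TopologicalSpace (Z i)]
    {φ : ModalFormula P} (h : ∀ i, φ.Valid (Z i)) : φ.Valid (Σ i, Z i) := by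
  rintro ν ⟨i, w⟩
  exact (truth_preimage continuous_sigmaMk isOpenMap_sigmaMk ν φ w).1 (h i _ w)

end Modal

/-! ### The Alexandroff extension -/

section Alexandroff

variable {P : Type v} {X : Type u} [TopologicalSpace X]

theorem IsOpenFilter.inf {F G : Filter X} (hF : IsOpenFilter F) (hG : IsOpenFilter G) :
    IsOpenFilter (F ⊓ G) := by
  intro A hA
  obtain ⟨B, hB, C, hC, rfl⟩ := Filter.mem_inf_iff.1 hA
  rw [interior_inter]
  exact Filter.inter_mem_inf (hF B hB) (hG C hC)

theorem isOpenFilter_principal {U : Set X} (hU : IsOpen U) : IsOpenFilter (Filter.principal U) :=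
  fun _ hA => interior_maximal hA hU

/-- The sets `{u | F ⊆ u}` are closed under finite intersections, so they form a base. -/
theorem AlexExt.exists_openFilter {S : Set (AlexExt X)} (hS : IsOpen S) {u : AlexExt X}
    (hu : u ∈ S) : ∃ F : Filter X, IsOpenFilter F ∧ (∀ A ∈ F, A ∈ u.toUltrafilter) ∧
      ∀ v : AlexExt X, (∀ A ∈ F, A ∈ v.toUltrafilter) → v ∈ S := by
  induction hS with
  | basic S h =>
    obtain ⟨F, hF, rfl⟩ := h
    exact ⟨F, hF, hu, fun _ h => h⟩
  | univ =>
    exact ⟨⊤, fun A hA => by simp_all, fun A hA => by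
      rw [Filter.mem_top.1 hA]; exact Filter.univ_mem, fun _ _ => trivial⟩
  | inter S T _ _ h₁ h₂ =>
    obtain ⟨F, hF, hFu, hFS⟩ := h₁ hu.1
    obtain ⟨G, hG, hGu, hGT⟩ := h₂ hu.2
    have hle : (u.toUltrafilter : Filter X) ≤ F ⊓ G := le_inf hFu hGu
    exact ⟨F ⊓ G, hF.inf hG, fun A hA => hle hA, fun v hv =>
      ⟨hFS v fun A hA => hv A (Filter.mem_inf_of_left hA),
        hGT v fun A hA => hv A (Filter.mem_inf_of_right hA)⟩⟩
  | sUnion 𝒮 _ h =>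
    obtain ⟨S, hS, huS⟩ := hu
    obtain ⟨F, hF, hFu, hFS⟩ := h S hS huS
    exact ⟨F, hF, hFu, fun v hv => ⟨S, hS, hFS v hv⟩⟩

theorem AlexExt.isOpen_setOf {F : Filter X} (hF : IsOpenFilter F) :
    IsOpen {u : AlexExt X | ∀ A ∈ F, A ∈ u.toUltrafilter} :=
  TopologicalSpace.isOpen_generateFrom_of_mem ⟨F, hF, rfl⟩

/-- The truth lemma: under the canonical valuation of the Alexandroff extension, a formula is true
at an ultrafilter exactly if its truth set in `X` belongs to that ultrafilter. -/
theorem ModalFormula.truth_alexExt (ν : P → Set X) (φ : ModalFormula P) (u : AlexExt X) :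
    φ.Truth (fun p => {u : AlexExt X | ν p ∈ u.toUltrafilter}) u ↔
      {w | φ.Truth ν w} ∈ u.toUltrafilter := by
  induction φ generalizing u with
  | top => exact iff_of_true trivial Filter.univ_mem
  | letter p => rfl
  | and φ ψ h₁ h₂ => exact (and_congr (h₁ u) (h₂ u)).trans Filter.inter_mem_iff.symm
  | neg φ h => exact (not_congr (h u)).trans Ultrafilter.compl_mem_iff_notMem.symm
  | box φ h =>
    have hset : {w | (ModalFormula.box φ).Truth ν w} = interior {w | φ.Truth ν w} :=
      Set.ext fun w => truth_box ν w φ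
    rw [hset]
    constructor
    · rintro ⟨O, hO, huO, hφ⟩
      obtain ⟨F, hF, hFu, hFO⟩ := AlexExt.exists_openFilter hO huO
      refine hFu _ (hF _ (Filter.mem_iff_ultrafilter.2 fun v hv => ?_))
      exact (h ⟨v⟩).1 (hφ _ (hFO _ fun A hA => hv hA))
    · intro hu
      refine ⟨_, AlexExt.isOpen_setOf (isOpenFilter_principal isOpen_interior),
        fun A hA => Filter.mem_of_superset hu hA, fun v hv => (h v).2 ?_⟩
      exact hv _ (Filter.mem_principal.2 interior_subset)

theorem ModalFormula.Valid.of_alexExt {φ : ModalFormula P} (h : φ.Valid (AlexExt X)) :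
    φ.Valid X := fun ν w =>
  (Ultrafilter.mem_pure).1 ((truth_alexExt ν φ ⟨pure w⟩).1 (h _ _))

end Alexandroff

theorem ModallyDefinable.closed {K : Set Space.{u}} (h : ModallyDefinable K) :
    ClosedUnderOpenSubspaces K ∧ ClosedUnderInteriorImages K ∧ ClosedUnderSums K ∧
      ReflectsAlexandroffExtensions K := by
  obtain ⟨Γ, hΓ⟩ := h
  refine ⟨fun X hX O hO hne => (hΓ _).2 fun φ hφ => ((hΓ X).1 hX φ hφ).of_isOpen hO,
    fun X hX Y f hc ho hf => (hΓ Y).2 fun φ hφ => ((hΓ X).1 hX φ hφ).of_surjective hc ho hf,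
    fun I _ X hX => (hΓ _).2 fun φ hφ => .sigma fun i => (hΓ (X i)).1 (hX i) φ hφ,
    fun X hX => (hΓ X).2 fun φ hφ => .of_alexExt ((hΓ _).1 hX φ hφ)⟩

/-! ### Invariance of `L_t` under a change of base -/

namespace L2

variable {P : Type v} {X : Type u}

/-- Monotonicity: enlarging the values of the open variables that occur positively, and shrinking
those of the ones that occur negatively, preserves satisfaction. Variables without free occurrences
may change freely. -/
theorem Sat.mono (σ : Set (Set X)) (ν : P → Set X) (φ : L2 P) {g g' : ℕ → X} {h h' : ℕ → Set X}
    (hg : ∀ x, FreePt x φ → g x = g' x) (hpos : ∀ U, FreeOp U true φ → h U ⊆ h' U)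
    (hneg : ∀ U, FreeOp U false φ → h' U ⊆ h U) (hφ : Sat σ ν g h φ) : Sat σ ν g' h' φ := by
  induction φ generalizing g g' h h' with
  | top => trivial
  | eqPt x y => exact (hg x (.inl rfl)).symm.trans (hφ.trans (hg y (.inr rfl)))
  | eqOp U V =>
    have hU : h U = h' U := (hpos U (.inl rfl)).antisymm (hneg U (.inl rfl))
    have hV : h V = h' V := (hpos V (.inr rfl)).antisymm (hneg V (.inr rfl))
    exact hU.symm.trans (Eq.trans hφ hV)
  | pred p x =>
    change g' x ∈ ν p
    rw [← hg x rfl]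
    exact hφ
  | mem x U =>
    change g' x ∈ h' U
    rw [← hg x rfl]
    exact hpos U ⟨rfl, rfl⟩ hφ
  | neg φ ih => exact fun h' => hφ (ih (fun x hx => (hg x hx).symm) hneg hpos h')
  | and φ ψ ih₁ ih₂ =>
    exact ⟨ih₁ (fun x hx => hg x (.inl hx)) (fun U hU => hpos U (.inl hU))
        (fun U hU => hneg U (.inl hU)) hφ.1,
      ih₂ (fun x hx => hg x (.inr hx)) (fun U hU => hpos U (.inr hU))
        (fun U hU => hneg U (.inr hU)) hφ.2⟩
  | exPt x φ ih =>
    obtain ⟨d, hd⟩ := hφ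
    refine ⟨d, ih (fun z hz => ?_) hpos hneg hd⟩
    rcases eq_or_ne z x with rfl | hzx
    · simp
    · simpa [hzx] using hg z ⟨hzx, hz⟩
  | exOp U φ ih =>
    obtain ⟨O, hO, hd⟩ := hφ
    refine ⟨O, hO, ih hg (fun V hV => ?_) (fun V hV => ?_) hd⟩
    · rcases eq_or_ne V U with rfl | hVU
      · simp
      · simpa [hVU] using hpos V ⟨hVU, hV⟩
    · rcases eq_or_ne V U with rfl | hVU
      · simp
      · simpa [hVU] using hneg V ⟨hVU, hV⟩

theorem IsSentence.sat_congr {φ : L2 P} (hφ : φ.IsSentence) {σ : Set (Set X)} {ν : P → Set X}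
    {g g' : ℕ → X} {h h' : ℕ → Set X} (hs : Sat σ ν g h φ) : Sat σ ν g' h' φ :=
  hs.mono σ ν φ (fun x hx => (hφ.1 x hx).elim) (fun U hU => (hφ.2 U _ hU).elim)
    fun U hU => (hφ.2 U _ hU).elim

theorem sat_update_mono_of_negativeIn {α : L2 P} {U : ℕ} (hα : NegativeIn U α)
    {σ : Set (Set X)} {ν : P → Set X} {g : ℕ → X} {h : ℕ → Set X} {B O : Set X} (hBO : B ⊆ O)
    (hs : Sat σ ν g (Function.update h U O) α) : Sat σ ν g (Function.update h U B) α := by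
  refine hs.mono σ ν α (fun _ _ => rfl) (fun V hV => ?_) (fun V hV => ?_) <;>
    rcases eq_or_ne V U with rfl | hVU
  · exact (hα hV).elim
  · simp [hVU]
  · simpa using hBO
  · simp [hVU]

theorem sat_update_mono_of_positiveIn {α : L2 P} {U : ℕ} (hα : PositiveIn U α)
    {σ : Set (Set X)} {ν : P → Set X} {g : ℕ → X} {h : ℕ → Set X} {B O : Set X} (hBO : B ⊆ O)
    (hs : Sat σ ν g (Function.update h U B) α) : Sat σ ν g (Function.update h U O) α := by
  refine hs.mono σ ν α (fun _ _ => rfl) (fun V hV => ?_) (fun V hV => ?_) <;>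
    rcases eq_or_ne V U with rfl | hVU
  · simpa using hBO
  · simp [hVU]
  · exact (hα hV).elim
  · simp [hVU]

theorem sat_allOp_imp_mem {α : L2 P} {x U : ℕ} {σ : Set (Set X)} {ν : P → Set X} {g : ℕ → X}
    {h : ℕ → Set X} : Sat σ ν g h (allOp U (imp (.mem x U) α)) ↔
      ∀ O ∈ σ, g x ∈ O → Sat σ ν g (Function.update h U O) α := by
  simp [allOp, imp, Sat]

/-- A formula of `L_t` cannot tell a topology from any of its bases. The assignment of the open
variables is arbitrary, which lets the induction pass through the open quantifiers. -/
theorem IsLt.sat_iff_of_isTopologicalBasis [TopologicalSpace X] {σ : Set (Set X)}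
    (hσ : TopologicalSpace.IsTopologicalBasis σ) (ν : P → Set X) {φ : L2 P} (hφ : φ.IsLt)
    (g : ℕ → X) (h : ℕ → Set X) :
    Sat {O : Set X | IsOpen O} ν g h φ ↔ Sat σ ν g h φ := by
  induction hφ generalizing g h with
  | top => rfl
  | eqPt x y => rfl
  | eqOp U V => rfl
  | pred p x => rfl
  | mem x U => rfl
  | neg _ ih => exact not_congr (ih g h)
  | and _ _ ih₁ ih₂ => exact and_congr (ih₁ g h) (ih₂ g h)
  | exPt x _ ih => exact exists_congr fun d => ih _ h
  | allOp x U _ hpos ih =>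
    rw [sat_allOp_imp_mem, sat_allOp_imp_mem]
    constructor
    · exact fun hs O hO hx => (ih _ _).1 (hs O (hσ.isOpen hO) hx)
    · intro hs O hO hx
      obtain ⟨B, hB, hxB, hBO⟩ := hσ.exists_subset_of_mem_open hx hO
      exact sat_update_mono_of_positiveIn hpos hBO ((ih _ _).2 (hs B hB hxB))
  | exOp x U _ hneg ih =>
    constructor
    · rintro ⟨O, hO, hx, hs⟩
      have hx' : g x ∈ O := by simpa [Sat] using hx
      obtain ⟨B, hB, hxB, hBO⟩ := hσ.exists_subset_of_mem_open hx' hO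
      exact ⟨B, hB, by simpa [Sat] using hxB,
        (ih _ _).1 (sat_update_mono_of_negativeIn hneg hBO hs)⟩
    · rintro ⟨O, hO, hx, hs⟩
      exact ⟨O, hσ.isOpen hO, hx, (ih _ _).2 hs⟩

end L2

/-! ### Iterated tensor powers of an ultrafilter -/

open Filter Set

section TensorPower

variable {I : Type u}

theorem exists_dependsOn_choice {α : Type v} [Nonempty α] {n : ℕ} {R : (ℕ → I) → α → Prop}
    (hR : DependsOn R (Iio n)) :
    ∃ d : (ℕ → I) → α, DependsOn d (Iio n) ∧ ∀ ω, (∃ a, R ω a) → R ω (d ω) :=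
  ⟨fun ω => Classical.epsilon (R ω), fun _ _ h => congrArg _ (hR h),
    fun _ h => Classical.epsilon_spec h⟩

variable [Nonempty I]

/-- The `n`-th tensor power of an ultrafilter `D`, as an ultrafilter on sequences that concentrates
on the first `n` coordinates. The last coordinate is quantified outermost: a property has to hold, for
almost every fixed value of it, for almost all values of the earlier ones. -/
noncomputable def tensorPow (D : Ultrafilter I) : ℕ → Ultrafilter (ℕ → I)
  | 0 => pure fun _ => Classical.arbitrary I
  | n + 1 => D.bind fun j => (tensorPow D n).map fun ω => Function.update ω n j

theorem eventually_tensorPow_succ {D : Ultrafilter I} {n : ℕ} {p : (ℕ → I) → Prop} :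
    (∀ᶠ ω in tensorPow D (n + 1), p ω) ↔
      ∀ᶠ j in D, ∀ᶠ ω in tensorPow D n, p (Function.update ω n j) :=
  Iff.rfl

theorem eventually_tensorPow_of_le {D : Ultrafilter I} {n m : ℕ} (hnm : n ≤ m)
    {p : (ℕ → I) → Prop} (hp : DependsOn p (Iio n)) :
    (∀ᶠ ω in tensorPow D m, p ω) ↔ ∀ᶠ ω in tensorPow D n, p ω := by
  induction m, hnm using Nat.le_induction with
  | base => rfl
  | succ m hnm ih =>
    have h (j : I) (ω : ℕ → I) : p (Function.update ω m j) = p ω :=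
      hp fun k hk => Function.update_of_ne ((mem_Iio.1 hk).trans_le hnm).ne _ _
    simp only [eventually_tensorPow_succ, h, eventually_const, ih]

/-- The limit of the tensor powers of `D`: for events that depend on the first `n` coordinates, it
agrees with the `n`-th power. -/
@[irreducible]
noncomputable def tensorLim (D : Ultrafilter I) : Ultrafilter (ℕ → I) :=
  (hyperfilter ℕ).bind (tensorPow D)

theorem eventually_tensorLim {D : Ultrafilter I} {n : ℕ} {p : (ℕ → I) → Prop}
    (hp : DependsOn p (Iio n)) :
    (∀ᶠ ω in tensorLim D, p ω) ↔ ∀ᶠ ω in tensorPow D n, p ω := by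
  have h : (∀ᶠ ω in tensorLim D, p ω) ↔
      ∀ᶠ m in (hyperfilter ℕ : Filter ℕ), ∀ᶠ ω in tensorPow D m, p ω := by
    rw [tensorLim]; rfl
  have hge : ∀ᶠ m in (hyperfilter ℕ : Filter ℕ), n ≤ m :=
    (Nat.cofinite_eq_atTop ▸ hyperfilter_le_cofinite : (hyperfilter ℕ : Filter ℕ) ≤ atTop)
      (eventually_ge_atTop n)
  rw [h, eventually_congr (hge.mono fun m hm => eventually_tensorPow_of_le hm hp), eventually_const]

/-- For events that depend on the first `n` coordinates and a parameter, substituting the next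
coordinate for the parameter amounts to quantifying the parameter over `D`, outermost. -/
theorem eventually_tensorLim_next {D : Ultrafilter I} {n : ℕ} {q : I → (ℕ → I) → Prop}
    (hq : ∀ j, DependsOn (q j) (Iio n)) :
    (∀ᶠ ω in tensorLim D, q (ω n) ω) ↔ ∀ᶠ j in D, ∀ᶠ ω in tensorLim D, q j ω := by
  have hq' : DependsOn (fun ω : ℕ → I => q (ω n) ω) (Iio (n + 1)) := by
    intro ω ω' h
    dsimp only
    rw [h n (mem_Iio.2 n.lt_succ_self), hq _ fun k hk => h k (mem_Iio.2 (Nat.lt_succ_of_lt hk))]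
  have h (j : I) (ω : ℕ → I) : q j (Function.update ω n j) = q j ω :=
    hq j fun k hk => Function.update_of_ne (mem_Iio.1 hk).ne _ _
  simp only [eventually_tensorLim hq', eventually_tensorPow_succ, Function.update_self, h,
    eventually_tensorLim (hq _)]

end TensorPower

/-! ### Limit ultrapowers of spaces -/

/-- The limit of the chain of iterated ultrapowers of `Y` along `D`: germs of families of
points, indexed by sequences, that depend on finitely many coordinates only. -/
def LimitPower {I : Type u} [Nonempty I] (D : Ultrafilter I) (Y : Type u) : Type u :=
  {y : Germ (tensorLim D : Filter (ℕ → I)) Y //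
    ∃ f : (ℕ → I) → Y, (∃ n, DependsOn f (Iio n)) ∧ y = Germ.ofFun f}

namespace LimitPower

variable {I : Type u} [Nonempty I] {D : Ultrafilter I} {Y : Type u}

/-- The point of the limit ultrapower given by a family that depends on finitely many
coordinates. -/
noncomputable def mk (f : (ℕ → I) → Y) (hf : ∃ n, DependsOn f (Iio n)) : LimitPower D Y :=
  ⟨Germ.ofFun f, f, hf, rfl⟩

theorem mk_eq_mk {f g : (ℕ → I) → Y} {hf : ∃ n, DependsOn f (Iio n)}
    {hg : ∃ n, DependsOn g (Iio n)} :
    (mk f hf : LimitPower D Y) = mk g hg ↔ ∀ᶠ ω in tensorLim D, f ω = g ω :=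
  Subtype.ext_iff.trans Germ.coe_eq

/-- A family representing a point of the limit ultrapower. -/
noncomputable def rep (y : LimitPower D Y) : (ℕ → I) → Y := y.2.choose

theorem exists_dependsOn_rep (y : LimitPower D Y) : ∃ n, DependsOn y.rep (Iio n) :=
  y.2.choose_spec.1

theorem mk_rep (y : LimitPower D Y) : mk y.rep y.exists_dependsOn_rep = y :=
  Subtype.ext y.2.choose_spec.2.symm

instance [Nonempty Y] : Nonempty (LimitPower D Y) :=
  ⟨mk (fun _ => Classical.arbitrary Y) ⟨0, fun _ _ _ => rfl⟩⟩

/-- The set of points of the limit ultrapower given by a family of sets. -/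
def internal (H : (ℕ → I) → Set Y) : Set (LimitPower D Y) :=
  {y | ∀ᶠ ω in tensorLim D, y.rep ω ∈ H ω}

theorem mk_mem_internal {f : (ℕ → I) → Y} {hf : ∃ n, DependsOn f (Iio n)}
    {H : (ℕ → I) → Set Y} :
    (mk f hf : LimitPower D Y) ∈ internal H ↔ ∀ᶠ ω in tensorLim D, f ω ∈ H ω := by
  have h := mk_eq_mk.1 (mk_rep (mk f hf : LimitPower D Y))
  exact eventually_congr (h.mono fun ω hω => by rw [hω])

theorem internal_subset_internal [Nonempty Y] {n : ℕ} {H H' : (ℕ → I) → Set Y}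
    (hH : DependsOn H (Iio n)) (hH' : DependsOn H' (Iio n)) :
    (internal H : Set (LimitPower D Y)) ⊆ internal H' ↔ ∀ᶠ ω in tensorLim D, H ω ⊆ H' ω := by
  constructor
  · intro hsub
    by_contra hne
    obtain ⟨d, hd, hdR⟩ := exists_dependsOn_choice (α := Y) (n := n)
      (R := fun ω y => y ∈ H ω ∧ y ∉ H' ω)
      fun ω ω' h => by dsimp only; rw [hH h, hH' h]
    have hne' : ∀ᶠ ω in tensorLim D, d ω ∈ H ω ∧ d ω ∉ H' ω :=
      (Ultrafilter.eventually_not.2 hne).mono fun ω hω => hdR ω (not_subset.1 hω)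
    have hmem := mk_mem_internal.1 (hsub
      (mk_mem_internal (hf := ⟨n, hd⟩).2 (hne'.mono fun _ h => h.1)))
    obtain ⟨ω, h₁, h₂⟩ := (hne'.and hmem).exists
    exact h₁.2 h₂
  · exact fun h y hy => (hy.and h).mono fun ω hω => hω.2 hω.1

theorem internal_univ : (internal fun _ => univ : Set (LimitPower D Y)) = univ :=
  eq_univ_of_forall fun _ => Eventually.of_forall fun _ => mem_univ _

variable [TopologicalSpace Y]

variable (D Y) in
/-- The internal open sets: those given by a family of open sets that depends on finitely many
coordinates. -/
def internalOpens : Set (Set (LimitPower D Y)) :=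
  {S | ∃ H : (ℕ → I) → Set Y, (∃ n, DependsOn H (Iio n)) ∧ (∀ ω, IsOpen (H ω)) ∧ S = internal H}

instance : TopologicalSpace (LimitPower D Y) := .generateFrom (internalOpens D Y)

theorem univ_mem_internalOpens : univ ∈ internalOpens D Y :=
  ⟨fun _ => univ, ⟨0, fun _ _ _ => rfl⟩, fun _ => isOpen_univ, internal_univ.symm⟩

theorem isTopologicalBasis_internalOpens :
    TopologicalSpace.IsTopologicalBasis (internalOpens D Y) where
  exists_subset_inter := by
    rintro _ ⟨H, ⟨n, hn⟩, hH, rfl⟩ _ ⟨H', ⟨m, hm⟩, hH', rfl⟩ y hy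
    refine ⟨internal fun ω => H ω ∩ H' ω, ⟨_, ⟨max n m, ?_⟩, fun ω => (hH ω).inter (hH' ω), rfl⟩,
      hy.1.and hy.2, fun z hz => ⟨hz.mono fun _ h => h.1, hz.mono fun _ h => h.2⟩⟩
    intro ω ω' h
    dsimp only
    rw [hn.mono (Iio_subset_Iio (le_max_left n m)) h, hm.mono (Iio_subset_Iio (le_max_right n m)) h]
  sUnion_eq := eq_univ_of_forall fun y => ⟨univ, univ_mem_internalOpens, mem_univ y⟩
  eq_generateFrom := rfl

/-- Łoś's theorem for limit ultrapowers, with the open variables ranging over the internal open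
sets. The assignments have to depend on a common finite set of coordinates, so that witnesses for
the quantifiers can be chosen to depend on the same ones. -/
theorem sat_internalOpens_iff [Nonempty Y] {P : Type v} (ν : P → Set Y) (φ : L2 P) {n : ℕ}
    {G : (ℕ → I) → ℕ → Y} {H : (ℕ → I) → ℕ → Set Y} (hG : DependsOn G (Iio n))
    (hH : DependsOn H (Iio n)) (hHo : ∀ ω U, IsOpen (H ω U)) :
    φ.Sat (internalOpens D Y) (fun p => internal fun _ => ν p)
        (fun x => mk (fun ω => G ω x) ⟨n, fun _ _ h => congrFun (hG h) x⟩)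
        (fun U => internal fun ω => H ω U) ↔
      ∀ᶠ ω in tensorLim D, φ.Sat {O | IsOpen O} ν (G ω) (H ω) := by
  induction φ generalizing n G H with
  | top => exact iff_of_true trivial (Eventually.of_forall fun _ => trivial)
  | eqPt x y => exact mk_eq_mk
  | eqOp U V =>
    have hU : DependsOn (fun ω => H ω U) (Iio n) := fun _ _ h => congrFun (hH h) U
    have hV : DependsOn (fun ω => H ω V) (Iio n) := fun _ _ h => congrFun (hH h) V
    simp only [L2.Sat, Subset.antisymm_iff, internal_subset_internal hU hV,
      internal_subset_internal hV hU, eventually_and]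
  | pred p x => exact mk_mem_internal
  | mem x U => exact mk_mem_internal
  | neg φ ih => exact (not_congr (ih hG hH hHo)).trans Ultrafilter.eventually_not.symm
  | and φ ψ ih₁ ih₂ => exact (and_congr (ih₁ hG hH hHo) (ih₂ hG hH hHo)).trans eventually_and.symm
  | exPt x φ ih =>
    have key {m : ℕ} (d : (ℕ → I) → Y) (hd : DependsOn d (Iio m)) :
        φ.Sat (internalOpens D Y) (fun p => internal fun _ => ν p)
          (Function.update (fun x => mk (fun ω => G ω x) ⟨n, fun _ _ h => congrFun (hG h) x⟩) x
            (mk d ⟨m, hd⟩)) (fun U => internal fun ω => H ω U) ↔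
        ∀ᶠ ω in tensorLim D, φ.Sat {O | IsOpen O} ν (Function.update (G ω) x (d ω)) (H ω) := by
      have hGm := hG.mono (Iio_subset_Iio (le_max_left n m))
      have hHm := hH.mono (Iio_subset_Iio (le_max_left n m))
      have hdm := hd.mono (Iio_subset_Iio (le_max_right n m))
      have hG' : DependsOn (fun ω => Function.update (G ω) x (d ω)) (Iio (max n m)) :=
        fun ω ω' h => by dsimp only; rw [hGm h, hdm h]
      rw [← ih hG' hHm hHo]
      refine iff_of_eq (congrArg (fun g => L2.Sat _ _ g _ φ) (funext fun y => ?_))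
      rcases eq_or_ne y x with rfl | hyx
      · simp
      · simp [hyx]
    constructor
    · rintro ⟨y, hy⟩
      obtain ⟨m, hm⟩ := y.exists_dependsOn_rep
      rw [← mk_rep y, key y.rep hm] at hy
      exact hy.mono fun ω hω => ⟨_, hω⟩
    · intro h
      obtain ⟨d, hd, hdR⟩ := exists_dependsOn_choice (n := n)
        (R := fun ω d => φ.Sat {O | IsOpen O} ν (Function.update (G ω) x d) (H ω))
        fun ω ω' h => by dsimp only; rw [hG h, hH h]
      exact ⟨_, (key d hd).2 (h.mono hdR)⟩
  | exOp U φ ih =>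
    have key {m : ℕ} (d : (ℕ → I) → Set Y) (hd : DependsOn d (Iio m)) (hdo : ∀ ω, IsOpen (d ω)) :
        φ.Sat (internalOpens D Y) (fun p => internal fun _ => ν p)
          (fun x => mk (fun ω => G ω x) ⟨n, fun _ _ h => congrFun (hG h) x⟩)
          (Function.update (fun U => internal fun ω => H ω U) U (internal d)) ↔
        ∀ᶠ ω in tensorLim D, φ.Sat {O | IsOpen O} ν (G ω) (Function.update (H ω) U (d ω)) := by
      have hGm := hG.mono (Iio_subset_Iio (le_max_left n m))
      have hHm := hH.mono (Iio_subset_Iio (le_max_left n m))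
      have hdm := hd.mono (Iio_subset_Iio (le_max_right n m))
      have hH' : DependsOn (fun ω => Function.update (H ω) U (d ω)) (Iio (max n m)) :=
        fun ω ω' h => by dsimp only; rw [hHm h, hdm h]
      have hHo' (ω : ℕ → I) (V : ℕ) : IsOpen (Function.update (H ω) U (d ω) V) := by
        rcases eq_or_ne V U with rfl | hVU
        · simpa using hdo ω
        · simpa [hVU] using hHo ω V
      rw [← ih hGm hH' hHo']
      refine iff_of_eq (congrArg (fun h => L2.Sat _ _ _ h φ) (funext fun V => ?_))
      rcases eq_or_ne V U with rfl | hVU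
      · simp
      · simp [hVU]
    constructor
    · rintro ⟨_, ⟨d, ⟨m, hm⟩, hdo, rfl⟩, hs⟩
      exact ((key d hm hdo).1 hs).mono fun ω hω => ⟨_, hdo ω, hω⟩
    · intro h
      obtain ⟨d, hd, hdR⟩ := exists_dependsOn_choice (n := n)
        (R := fun ω O => IsOpen O ∧ φ.Sat {O | IsOpen O} ν (G ω) (Function.update (H ω) U O))
        fun ω ω' h => by dsimp only; rw [hG h, hH h]
      -- Where there is no witness, `d ω` need not be open; taking interiors repairs this.
      have hd' : DependsOn (fun ω => interior (d ω)) (Iio n) := fun _ _ h => congrArg _ (hd h)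
      refine ⟨_, ⟨_, ⟨n, hd'⟩, fun ω => isOpen_interior, rfl⟩,
        (key _ hd' fun _ => isOpen_interior).2 (h.mono fun ω hω => ?_)⟩
      rw [(hdR ω hω).1.interior_eq]
      exact (hdR ω hω).2

theorem holdsIn [Nonempty Y] {φ : L2 Empty} (hφ : φ.IsLt) (hs : φ.IsSentence)
    (h : φ.HoldsIn Y) : φ.HoldsIn (LimitPower D Y) := by
  intro g k _
  rw [hφ.sat_iff_of_isTopologicalBasis isTopologicalBasis_internalOpens]
  have hlos := (sat_internalOpens_iff (D := D) (fun p : Empty => p.elim) φ (n := 0)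
    (G := fun _ _ => Classical.arbitrary Y) (H := fun _ _ => univ) (fun _ _ _ => rfl)
    (fun _ _ _ => rfl) fun _ _ => isOpen_univ).2
    (Eventually.of_forall fun _ => h _ _ fun _ => isOpen_univ)
  rw [show (fun p : Empty => p.elim : Empty → Set (LimitPower D Y)) = _ from
    funext fun p => p.elim]
  exact hs.sat_congr hlos

end LimitPower

/-- `L_t`-definable classes are closed under limit ultrapowers. -/
theorem LtDefinable.limitPower_mem {K : Set Space.{u}} (hK : LtDefinable K) {Y : Space.{u}}
    (hY : Y ∈ K) {I : Type u} [Nonempty I] (D : Ultrafilter I) :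
    ({ carrier := LimitPower D Y } : Space.{u}) ∈ K := by
  obtain ⟨Γ, hΓ, hK⟩ := hK
  exact (hK _).2 fun φ hφ => LimitPower.holdsIn (hΓ φ hφ).1 (hΓ φ hφ).2 ((hK Y).1 hY φ hφ)

/-! ### Spaces satisfying the finite parts of the diagram of `X` -/

section Diagram

variable {X Y : Type u} [TopologicalSpace X] [TopologicalSpace Y]

/-- For a valuation `ν` on `Y` with one letter for each subset of `X`, the set of points of `Y` at
which `ν` respects the Boolean operations and the interior operator on the members of `i`. -/
def diagram (ν : Set X → Set Y) (i : Finset (Set X)) : Set Y :=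
  {y | ∀ A ∈ i, ∀ B ∈ i, (y ∈ ν (A ∩ B) ↔ y ∈ ν A ∧ y ∈ ν B) ∧ (y ∈ ν Aᶜ ↔ y ∉ ν A) ∧
    (y ∈ ν (interior A) ↔ y ∈ interior (ν A))}

variable {P : Type v}

/-- The biconditional of two modal formulas. -/
def ModalFormula.iff (φ ψ : ModalFormula P) : ModalFormula P :=
  .and (.neg (.and φ (.neg ψ))) (.neg (.and ψ (.neg φ)))

theorem ModalFormula.truth_iff (ν : P → Set Y) (y : Y) (φ ψ : ModalFormula P) :
    (φ.iff ψ).Truth ν y ↔ (φ.Truth ν y ↔ ψ.Truth ν y) := by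
  simp only [ModalFormula.iff, Truth]
  tauto

/-- The conjunction of a finite family of modal formulas. -/
noncomputable def ModalFormula.conj {α : Type*} (s : Finset α) (ψ : α → ModalFormula P) :
    ModalFormula P :=
  s.toList.foldr (fun a φ => (ψ a).and φ) .top

theorem ModalFormula.truth_conj {α : Type*} (ν : P → Set Y) (y : Y) (s : Finset α)
    (ψ : α → ModalFormula P) : (conj s ψ).Truth ν y ↔ ∀ a ∈ s, (ψ a).Truth ν y := by
  have h (l : List α) : (l.foldr (fun a φ => (ψ a).and φ) .top).Truth ν y ↔
      ∀ a ∈ l, (ψ a).Truth ν y := by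
    induction l with
    | nil => simp [Truth]
    | cons a l ih => simp [Truth, ih]
  simpa only [conj, Finset.mem_toList] using h s.toList

/-- The modal formula that defines `diagram`, where the letter `e A` stands for the subset `A`. -/
noncomputable def diagramFormula (e : Set X → P) (i : Finset (Set X)) : ModalFormula P :=
  .conj i fun A => .conj i fun B =>
    .and (.iff (.letter (e (A ∩ B))) (.and (.letter (e A)) (.letter (e B))))
      (.and (.iff (.letter (e Aᶜ)) (.neg (.letter (e A))))
        (.iff (.letter (e (interior A))) (.box (.letter (e A)))))

theorem truth_diagramFormula (e : Set X → P) (i : Finset (Set X)) (μ : P → Set Y) (y : Y) :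
    (diagramFormula e i).Truth μ y ↔ y ∈ diagram (fun A => μ (e A)) i := by
  have hbox (A : Set X) : (ModalFormula.box (.letter (e A))).Truth μ y ↔ y ∈ interior (μ (e A)) :=
    ModalFormula.truth_box μ y _
  simp only [diagramFormula, ModalFormula.truth_conj, ModalFormula.truth_iff, hbox,
    ModalFormula.Truth.eq_2, ModalFormula.Truth.eq_3, ModalFormula.Truth.eq_4]
  rfl

/-- Membership in a diagram is local, hence pulls back along continuous open maps. -/
theorem diagram_preimage {Z : Type u} [TopologicalSpace Z] {f : Z → Y} (hc : Continuous f)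
    (ho : IsOpenMap f) (ν : Set X → Set Y) (i : Finset (Set X)) :
    diagram (fun A => f ⁻¹' ν A) i = f ⁻¹' diagram ν i := by
  ext z
  simp only [diagram, ← ho.preimage_interior_eq_interior_preimage hc]
  rfl

/-- If the modal logic of `K` is valid in `X`, then each finite part of the diagram of `X` holds
throughout an open set of some member of `K`, together with the letter of any given singleton. -/
theorem exists_mem_interior_diagram {K : Set Space.{u}} {X : Space.{u}}
    (hX : ∀ φ : ModalFormula ℕ, (∀ Z ∈ K, φ.Valid Z) → φ.Valid X) (i : Finset (Set X)) (w : X) :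
    ∃ Z ∈ K, ∃ (ν : Set X → Set Z) (z : Z), z ∈ interior (diagram ν i) ∧ z ∈ ν {w} := by
  classical
  -- Only finitely many of the letters occur, so countably many suffice.
  let L : Set (Set X) := insert {w} (↑i ∪ image2 (· ∩ ·) i i ∪ compl '' i ∪ interior '' i)
  have hL : L.Countable := by
    refine Finite.countable (Finite.insert _ ?_)
    have hi := i.finite_toSet
    exact ((hi.union (hi.image2 _ hi)).union (hi.image _)).union (hi.image _)
  obtain ⟨e, he⟩ := countable_iff_exists_injOn.1 hL
  by_contra! hne
  let ψ : ModalFormula ℕ := .and (.box (diagramFormula e i)) (.letter (e {w}))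
  have hψ {Z : Space.{u}} (μ : ℕ → Set Z) (z : Z) : ψ.Truth μ z ↔
      z ∈ interior (diagram (fun A => μ (e A)) i) ∧ z ∈ μ (e {w}) := by
    simp only [ψ, ModalFormula.Truth.eq_3, ModalFormula.truth_box, truth_diagramFormula,
      ofPred_mem_eq, ModalFormula.Truth.eq_2]
  have hval : (ModalFormula.neg ψ).Valid X := hX _ fun Z hZ μ z hz =>
    hne Z hZ _ z ((hψ μ z).1 hz).1 ((hψ μ z).1 hz).2
  let μ : ℕ → Set X := fun n => {x | ∃ A ∈ L, e A = n ∧ x ∈ A}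
  have hμ {A : Set X} (hA : A ∈ L) : μ (e A) = A := by
    ext x
    exact ⟨fun ⟨B, hB, hBA, hx⟩ => he hB hA hBA ▸ hx, fun hx => ⟨A, hA, rfl, hx⟩⟩
  refine hval μ w ((hψ μ w).2 ⟨?_, ?_⟩)
  · have huniv : diagram (fun A => μ (e A)) i = univ := by
      refine eq_univ_of_forall fun x A hA B hB => ?_
      have hA' : A ∈ L := .inr (.inl (.inl (.inl hA)))
      have hB' : B ∈ L := .inr (.inl (.inl (.inl hB)))
      have h₁ : A ∩ B ∈ L := .inr (.inl (.inl (.inr ⟨A, hA, B, hB, rfl⟩)))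
      have h₂ : Aᶜ ∈ L := .inr (.inl (.inr ⟨A, hA, rfl⟩))
      have h₃ : interior A ∈ L := .inr (.inr ⟨A, hA, rfl⟩)
      simp only [hμ hA', hμ hB', hμ h₁, hμ h₂, hμ h₃]
      simp
    rw [huniv, interior_univ]
    trivial
  · rw [hμ (.inl rfl)]
    rfl

/-- By closure under sums, a single member of `K` satisfies all finite parts of the diagram. -/
theorem exists_valuation_of_sums {K : Set Space.{u}} (hsum : ClosedUnderSums K) {X : Space.{u}}
    (hX : ∀ φ : ModalFormula ℕ, (∀ Z ∈ K, φ.Valid Z) → φ.Valid X) :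
    ∃ Y ∈ K, ∃ ν : Set X → Set Y, ∀ (i : Finset (Set X)) (w : X),
      ∃ y ∈ interior (diagram ν i), y ∈ ν {w} := by
  choose Z hZ ν z hz hzw using exists_mem_interior_diagram hX
  refine ⟨_, hsum (Finset (Set X) × X) (fun p => Z p.1 p.2) fun p => hZ p.1 p.2,
    fun A => {y | y.2 ∈ ν y.1.1 y.1.2 A}, fun i w => ⟨⟨(i, w), z i w⟩, ?_, hzw i w⟩⟩
  have h := hz i w
  have hpre : diagram (ν i w) i = Sigma.mk (i, w) ⁻¹' diagram
      (fun A => {y : Σ p : Finset (Set X) × X, Z p.1 p.2 | y.2 ∈ ν y.1.1 y.1.2 A}) i := by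
    rw [← diagram_preimage continuous_sigmaMk isOpenMap_sigmaMk]
    rfl
  rw [hpre, ← isOpenMap_sigmaMk.preimage_interior_eq_interior_preimage continuous_sigmaMk] at h
  exact h

end Diagram

/-! ### The Alexandroff extension as an interior image -/

theorem eventually_mem_coordinate {ι : Type u} {D : Ultrafilter (Finset ι)}
    (hD : (D : Filter (Finset ι)) ≤ atTop) (n : ℕ) (a : ι) :
    ∀ᶠ ω : ℕ → Finset ι in (tensorLim D : Filter (ℕ → Finset ι)), a ∈ ω n := by
  refine (eventually_tensorLim_next (q := fun j _ => a ∈ j) fun _ _ _ _ => rfl).2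
    (((eventually_ge_atTop {a}).filter_mono hD).mono fun j hj => Eventually.of_forall fun _ => ?_)
  exact hj (Finset.mem_singleton_self a)

namespace LimitPower

/-- Limit ultrapowers along a fine ultrafilter realize types over an internal set `H`: if `H`
depends on `n` coordinates, the coordinate `n` supplies a hyperfinite set containing all indices,
and for each fixed value of it finite satisfiability holds almost everywhere. In a single
ultrapower this would require a good ultrafilter. -/
theorem exists_mem_internal {ι Y : Type u} [Nonempty Y] {D : Ultrafilter (Finset ι)}
    (hD : (D : Filter (Finset ι)) ≤ atTop) {n : ℕ} {H : (ℕ → Finset ι) → Set Y}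
    (hH : DependsOn H (Iio n)) (V : ι → Set Y) (t : Set ι)
    (hfin : ∀ s : Finset ι, ↑s ⊆ t → ∀ᶠ ω in tensorLim D, ∃ y ∈ H ω, ∀ a ∈ s, y ∈ V a) :
    ∃ y : LimitPower D Y, y ∈ internal H ∧ ∀ a ∈ t, y ∈ internal fun _ => V a := by
  classical
  obtain ⟨d, hd, hdR⟩ := exists_dependsOn_choice (n := n + 1)
    (R := fun ω y => y ∈ H ω ∧ ∀ a ∈ ω n, a ∈ t → y ∈ V a) fun ω ω' h => by
      dsimp only
      rw [hH fun k hk => h k (Iio_subset_Iio n.le_succ hk), h n (mem_Iio.2 n.lt_succ_self)]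
  have hex : ∀ᶠ ω in tensorLim D, d ω ∈ H ω ∧ ∀ a ∈ ω n, a ∈ t → d ω ∈ V a := by
    refine Eventually.mono ((eventually_tensorLim_next
      (q := fun j ω => ∃ y, y ∈ H ω ∧ ∀ a ∈ j, a ∈ t → y ∈ V a)
      fun j ω ω' h => by dsimp only; rw [hH h]).2 (Eventually.of_forall fun j => ?_)) hdR
    refine (hfin (j.filter (· ∈ t)) fun a ha => (Finset.mem_filter.1 ha).2).mono ?_
    rintro ω ⟨y, hy, hyV⟩
    exact ⟨y, hy, fun a haj hat => hyV a (Finset.mem_filter.2 ⟨haj, hat⟩)⟩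
  refine ⟨mk d ⟨n + 1, hd⟩, mk_mem_internal.2 (hex.mono fun _ h => h.1), fun a ha =>
    mk_mem_internal.2 ?_⟩
  filter_upwards [hex, eventually_mem_coordinate hD n a] with ω h haω using h.2 a haω ha

end LimitPower

section InteriorImage

variable {X Y : Type u} [TopologicalSpace X] [TopologicalSpace Y]
  {D : Ultrafilter (Finset (Set X))} {ν : Set X → Set Y}

open LimitPower

variable (D ν) in
/-- The internal open set of those points of the limit ultrapower near which the whole diagram of
`X` holds: `ω 0` is a hyperfinite set containing all subsets of `X`. -/
def diagramPart : Set (LimitPower D Y) := internal fun ω => interior (diagram ν (ω 0))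

theorem isOpen_diagramPart : IsOpen (diagramPart D ν) :=
  isTopologicalBasis_internalOpens.isOpen ⟨_, ⟨1, fun ω ω' h => by
    rw [h 0 (mem_Iio.2 one_pos)]⟩, fun _ => isOpen_interior, rfl⟩

variable (hD : (D : Filter (Finset (Set X))) ≤ atTop)
include hD

theorem eventually_diagram {H : (ℕ → Finset (Set X)) → Set Y}
    (hH : ∀ ω, H ω ⊆ interior (diagram ν (ω 0))) (A B : Set X) :
    ∀ᶠ ω in tensorLim D, ∀ y ∈ H ω, (y ∈ ν (A ∩ B) ↔ y ∈ ν A ∧ y ∈ ν B) ∧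
      (y ∈ ν Aᶜ ↔ y ∉ ν A) ∧ (y ∈ ν (interior A) ↔ y ∈ interior (ν A)) := by
  filter_upwards [eventually_mem_coordinate hD 0 A, eventually_mem_coordinate hD 0 B]
    with ω hA hB y hy using interior_subset (hH ω hy) A hA B hB

theorem eventually_rep_diagram (y : diagramPart D ν) (A B : Set X) :
    ∀ᶠ ω in tensorLim D, (y.1.rep ω ∈ ν (A ∩ B) ↔ y.1.rep ω ∈ ν A ∧ y.1.rep ω ∈ ν B) ∧
      (y.1.rep ω ∈ ν Aᶜ ↔ y.1.rep ω ∉ ν A) ∧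
      (y.1.rep ω ∈ ν (interior A) ↔ y.1.rep ω ∈ interior (ν A)) :=
  y.2.mp ((eventually_diagram hD (fun _ => Subset.rfl) A B).mono fun _ h hy => h _ hy)

/-- The map to the Alexandroff extension: a point of the limit ultrapower goes to the ultrafilter of
those `A` whose letter holds at the point. -/
noncomputable def toAlexExt (y : diagramPart D ν) : AlexExt X where
  toUltrafilter := .ofComplNotMemIff
    { sets := {A | y.1 ∈ internal fun _ => ν A}
      univ_sets := by
        filter_upwards [eventually_rep_diagram hD y univ ∅] with ω h
        simp only [compl_univ, univ_inter] at h
        tauto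
      sets_of_superset := by
        intro A B hA hAB
        filter_upwards [eventually_rep_diagram hD y A B, hA] with ω h hA
        rw [inter_eq_self_of_subset_left hAB] at h
        exact (h.1.1 hA).2
      inter_sets := by
        intro A B hA hB
        filter_upwards [eventually_rep_diagram hD y A B, hA, hB] with ω h hA hB
        exact h.1.2 ⟨hA, hB⟩ }
    fun A => by
      have h : (∀ᶠ ω in tensorLim D, y.1.rep ω ∈ ν Aᶜ) ↔ ¬ ∀ᶠ ω in tensorLim D, y.1.rep ω ∈ ν A :=
        (eventually_congr ((eventually_rep_diagram hD y A A).mono fun ω h => h.2.1)).trans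
          Ultrafilter.eventually_not
      exact (not_congr h).trans not_not

theorem mem_toAlexExt {y : diagramPart D ν} {A : Set X} :
    A ∈ (toAlexExt hD y).toUltrafilter ↔ y.1 ∈ internal fun _ => ν A :=
  Iff.rfl

theorem toAlexExt_eq {y : diagramPart D ν} {u : AlexExt X}
    (h : ∀ A ∈ u.toUltrafilter, y.1 ∈ internal fun _ => ν A) : toAlexExt hD y = u :=
  congrArg AlexExt.mk (Ultrafilter.coe_le_coe.1 fun A hA => h A hA)

theorem continuous_toAlexExt : Continuous (toAlexExt hD : diagramPart D ν → AlexExt X) := by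
  classical
  refine continuous_generateFrom_iff.2 ?_
  rintro _ ⟨F, hF, rfl⟩
  refine isOpen_iff_forall_mem_open.2 fun y hy => ?_
  obtain ⟨n, hn⟩ := y.1.exists_dependsOn_rep
  -- Cut down to the finitely many members `A` of `F` in `ω n` that behave as expected at `ω`;
  -- almost everywhere this includes any given member of `F`.
  let s (ω : ℕ → Finset (Set X)) : Finset (Set X) :=
    (ω n).filter fun A => A ∈ F ∧ y.1.rep ω ∈ interior (ν A)
  have hs : DependsOn s (Iio (n + 1)) := fun ω ω' h => by
    simp only [s]
    rw [h n (mem_Iio.2 n.lt_succ_self), hn fun k hk => h k (Iio_subset_Iio n.le_succ hk)]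
  let U (ω : ℕ → Finset (Set X)) : Set Y := ⋂ A ∈ s ω, interior (ν A)
  have hU : IsOpen (internal U : Set (LimitPower D Y)) := isTopologicalBasis_internalOpens.isOpen
    ⟨U, ⟨n + 1, fun ω ω' h => by simp only [U, hs h]⟩,
      fun ω => isOpen_biInter_finset fun _ _ => isOpen_interior, rfl⟩
  refine ⟨Subtype.val ⁻¹' internal U, fun z hz A hA => (mem_toAlexExt hD).2 ?_,
    hU.preimage continuous_subtype_val,
    Eventually.of_forall fun ω => mem_iInter₂.2 fun A hA => (Finset.mem_filter.1 hA).2.2⟩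
  filter_upwards [hz, eventually_mem_coordinate hD n A, hy _ (hF A hA),
    eventually_rep_diagram hD y A A] with ω hzU hAω hyA hd
  exact interior_subset (mem_iInter₂.1 hzU A (Finset.mem_filter.2 ⟨hAω, hA, hd.2.2.1 hyA⟩))

variable [Nonempty Y]

theorem isOpenMap_toAlexExt : IsOpenMap (toAlexExt hD : diagramPart D ν → AlexExt X) := by
  refine (isTopologicalBasis_internalOpens.induced Subtype.val).isOpenMap_iff.2 ?_
  rintro _ ⟨_, ⟨H, ⟨n, hn⟩, hHo, rfl⟩, rfl⟩
  let H' (ω : ℕ → Finset (Set X)) : Set Y := H ω ∩ interior (diagram ν (ω 0))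
  have hH' : DependsOn H' (Iio (max n 1)) := fun ω ω' h => by
    simp only [H']
    rw [hn.mono (Iio_subset_Iio (le_max_left n 1)) h,
      h 0 (mem_Iio.2 (one_pos.trans_le (le_max_right n 1)))]
  have hmem (y : LimitPower D Y) : y ∈ internal H' ↔ y ∈ internal H ∧ y ∈ diagramPart D ν :=
    eventually_and
  -- The image consists of the ultrafilters extending the intersection of its members.
  let F : Filter X := ⨆ y ∈ (Subtype.val ⁻¹' internal H : Set (diagramPart D ν)),
    ((toAlexExt hD y).toUltrafilter : Filter X)
  have hF (A : Set X) : A ∈ F ↔ ∀ᶠ ω in tensorLim D, H' ω ⊆ ν A := by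
    rw [← internal_subset_internal (D := D) hH' (H' := fun _ => ν A) fun _ _ _ => rfl]
    simp only [F, mem_iSup]
    exact ⟨fun h y hy => h ⟨y, ((hmem y).1 hy).2⟩ ((hmem y).1 hy).1,
      fun h y hy => h ((hmem y).2 ⟨hy, y.2⟩)⟩
  have hFo : IsOpenFilter F := by
    intro A hA
    rw [hF] at hA ⊢
    filter_upwards [hA, eventually_diagram hD (H := H') (fun ω => inter_subset_right) A A]
      with ω hA hd y hy
    exact (hd y hy).2.2.2 (interior_maximal hA ((hHo ω).inter isOpen_interior) hy)
  convert AlexExt.isOpen_setOf hFo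
  ext u
  constructor
  · rintro ⟨y, hy, rfl⟩ A hA
    exact mem_iSup.1 (mem_iSup.1 hA y) hy
  · intro hu
    obtain ⟨y, hyH, hyu⟩ := exists_mem_internal hD hH' ν {A | A ∈ u.toUltrafilter} fun s hs => by
      by_contra hne
      have hB : ⋂₀ (s : Set (Set X)) ∈ u.toUltrafilter :=
        (sInter_mem s.finite_toSet).2 fun A hA => hs hA
      refine Ultrafilter.compl_mem_iff_notMem.1 (hu _ ?_) hB
      refine mem_iSup.2 fun y => mem_iSup.2 fun hy => Ultrafilter.compl_mem_iff_notMem.2 fun hyB => ?_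
      have hys : ∀ᶠ ω in tensorLim D, ∀ A ∈ s, y.1.rep ω ∈ ν A :=
        (Finset.eventually_all s).2 fun A hA => (mem_toAlexExt hD).1
          (mem_of_superset hyB (sInter_subset_of_mem hA))
      refine hne ?_
      filter_upwards [hys, (hmem y.1).2 ⟨hy, y.2⟩] with ω h₁ h₂ using ⟨_, h₂, h₁⟩
    have hy := (hmem y).1 hyH
    exact ⟨⟨y, hy.2⟩, hy.1, toAlexExt_eq hD hyu⟩

theorem surjective_toAlexExt (hν : ∀ (i : Finset (Set X)) (w : X),
      ∃ y ∈ interior (diagram ν i), y ∈ ν {w}) :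
    Function.Surjective (toAlexExt hD : diagramPart D ν → AlexExt X) := by
  intro u
  obtain ⟨y, hy, hyu⟩ := exists_mem_internal (Y := Y) hD (n := 1)
    (H := fun ω => interior (diagram ν (ω 0)))
    (fun ω ω' h => by dsimp only; rw [h 0 (mem_Iio.2 one_pos)]) ν {A | A ∈ u.toUltrafilter}
    fun s hs => by
      have hB : ⋂₀ (s : Set (Set X)) ∈ u.toUltrafilter :=
        (sInter_mem s.finite_toSet).2 fun A hA => hs hA
      obtain ⟨w, hw⟩ := u.toUltrafilter.nonempty_of_mem hB
      filter_upwards [(Finset.eventually_all s).2 fun A _ =>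
        eventually_diagram (ν := ν) hD (fun _ => Subset.rfl) {w} A] with ω h
      obtain ⟨y, hy, hyw⟩ := hν (ω 0) w
      refine ⟨y, hy, fun A hA => ?_⟩
      have := (h A hA y hy).1
      rw [inter_eq_self_of_subset_left (singleton_subset_iff.2 (hw A hA))] at this
      exact (this.1 hyw).2
  exact ⟨⟨y, hy⟩, toAlexExt_eq hD hyu⟩

end InteriorImage

/-- A space that validates the modal logic of `K` belongs to `K`. -/
theorem mem_of_logic_valid {K : Set Space.{u}} (hK : LtDefinable K)
    (hopen : ClosedUnderOpenSubspaces K) (himage : ClosedUnderInteriorImages K)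
    (hsum : ClosedUnderSums K) (halex : ReflectsAlexandroffExtensions K) {X : Space.{u}}
    (hX : ∀ φ : ModalFormula ℕ, (∀ Z ∈ K, φ.Valid Z) → φ.Valid X) : X ∈ K := by
  obtain ⟨Y, hY, ν, hν⟩ := exists_valuation_of_sums hsum hX
  let D : Ultrafilter (Finset (Set X)) := Ultrafilter.of atTop
  have hD : (D : Filter (Finset (Set X))) ≤ atTop := Ultrafilter.of_le _
  have hsurj := surjective_toAlexExt hD hν
  have hne : (diagramPart D ν).Nonempty := by
    obtain ⟨y, -⟩ := hsurj (Classical.arbitrary (AlexExt X))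
    exact ⟨y.1, y.2⟩
  exact halex X (himage _ (hopen _ (hK.limitPower_mem hY D) _ isOpen_diagramPart hne)
    X.alexandroffExtension (toAlexExt hD) (continuous_toAlexExt hD) (isOpenMap_toAlexExt hD) hsurj)

end TopoModal

theorem theorem3p17 (K : Set TopoModal.Space.{u}) (hK : TopoModal.LtDefinable K) :
    TopoModal.ModallyDefinable K ↔
      TopoModal.ClosedUnderOpenSubspaces K ∧
      TopoModal.ClosedUnderInteriorImages K ∧
      TopoModal.ClosedUnderSums K ∧
      TopoModal.ReflectsAlexandroffExtensions K := by
  refine ⟨TopoModal.ModallyDefinable.closed, fun ⟨hopen, himage, hsum, halex⟩ =>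
    ⟨{φ | ∀ Z ∈ K, φ.Valid Z}, fun X => ⟨fun hX φ hφ => hφ X hX, fun hX => ?_⟩⟩⟩
  exact TopoModal.mem_of_logic_valid hK hopen himage hsum halex hX
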